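/- Let $k$ be an algebraically closed field, let $n,i$ be integers with $0\le i\le n-2$, and let $X$ be a finite set of distinct points spanning $\mathbb{P}^n=\mathbb{P}^n_k$. Assume that 1. there are $n-i+1$ points of $X$ on some linear subspace $\mathbb{P}^{n-i-1}$ of $\mathbb{P}^n$; 2. $n-i$ points of $X$ never lie on a $\mathbb{P}^{n-i-2}$. Choose homogeneous coordinates $x_0,\dots,x_n$ such that all coordinate points belong to $X$ and the linear subspace $x_{n-i}=\dots=x_n=0$ contains $n-i+1$ points of $X$ (by 1 and 2 such coordinates exist). Let $R=k[x_0,\dots,x_n]$, let $I\subset R$ be the homogeneous ideal of $X$ and $I_2$ its degree $2$ part. Let $V$ be a $k$-vector space with basis $e_0,\dots,e_n$, and let $$\alpha=\sum_{|J|=n-2}\epsilon_J\otimes F_{\{0,\dots,n\}\setminus J}\in \textstyle\bigwedge^{n-2}V\otimes I_2$$ be an element of the kernel of the Koszul differential of $x_0,\dots,x_n$ on $\bigwedge^{n-2}V\otimes R$, where $\epsilon_J=e_{j_1}\wedge\dots\wedge e_{j_{n-2}}$ for $J=\{j_1<\dots<j_{n-2}\}\subset\{0,\dots,n\}$. (The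 dimension of the space of all such $\alpha$ is $a_{n-1}(X)=\dim_k[\mathrm{Tor}^R_{n-1}(R/I,k)]_n$.) Write $F_{abc}$ for $F_{\{a,b,c\}}\in I_2$. For $0\le a<b\le n-i-1$ and $n-i\le j\le n$ the quadric $F_{abj}$ is divisible by $x_j$; write $F_{abj}=x_jL^j_{ab}$ with a linear form $L^j_{ab}$, and let $W_j$ be the $k$-vector space spanned by all $L^j_{ab}$ with $0\le a<b\le n-i-1$. If $\dim_k W_j\ge n-i-1$ for some $j\in\{n-i,\dots,n\}$, then $X\subset \mathbb{P}^r\cup\mathbb{P}^s$, the union of an $r$-dimensional and an $s$-dimensional linear subspace of $\mathbb{P}^n$, for some positive integers $r$ and $s$ with $r+s=n$. -/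

import Mathlib

open scoped LinearAlgebra.Projectivization

noncomputable section

/-- The point `P` of projective space lies on the linear subspace `ℙ(S)`; if `S` has vector space
dimension `m + 1`, then `ℙ(S)` is a `ℙ^m`. -/
def LiesOn {k V : Type*} [Field k] [AddCommGroup V] [Module k V]
    (P : ℙ k V) (S : Submodule k V) : Prop :=
  P.submodule ≤ S

/-- Homogeneous coordinates `(x_0, …, x_n)` of (the chosen representative of) a point of `ℙ^n`,
with respect to the coordinate system given by the basis `e`. -/
def homCoords {k : Type*} [Field k] {n : ℕ}
    (e : Module.Basis (Fin (n + 1)) k (Fin (n + 1) → k))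
    (P : ℙ k (Fin (n + 1) → k)) : Fin (n + 1) → k :=
  fun l => e.repr P.rep l

/-- The homogeneous defining ideal `I(X) ⊆ k[x_0, …, x_n]` in the coordinates given by `e`: it is
generated by the homogeneous polynomials vanishing at all points of `X`. -/
def definingIdeal {k : Type*} [Field k] {n : ℕ}
    (e : Module.Basis (Fin (n + 1)) k (Fin (n + 1) → k))
    (X : Finset (ℙ k (Fin (n + 1) → k))) : Ideal (MvPolynomial (Fin (n + 1)) k) :=
  Ideal.span {f | ∃ d : ℕ, f.IsHomogeneous d ∧
    ∀ P ∈ X, MvPolynomial.eval (homCoords e P) f = 0}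

/-- The Koszul differential of `x_0, …, x_n` on `⋀V ⊗ R`, where `R = k[x_0, …, x_n]` and `V` has
basis `e_0, …, e_n`. An element `∑_J ε_J ⊗ α_J` (with `ε_J = e_{j_1} ∧ ⋯ ∧ e_{j_p}` for
`J = {j_1 < ⋯ < j_p}`) is represented by the family `J ↦ α_J` of its coefficients, and
`ε_J ⊗ f ↦ ∑_t (-1)^(t-1) ε_{J \ {j_t}} ⊗ x_{j_t} f`; the coefficient of the image at `T` therefore
collects the contributions of all `J = T ∪ {a}` with `a ∉ T`. -/
def koszulDiff (k : Type*) [Field k] (n : ℕ) :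
    (Finset (Fin (n + 1)) → MvPolynomial (Fin (n + 1)) k) →ₗ[MvPolynomial (Fin (n + 1)) k]
      (Finset (Fin (n + 1)) → MvPolynomial (Fin (n + 1)) k) where
  toFun α T := ∑ a ∈ Tᶜ,
    (-1) ^ (T.filter (fun t => t < a)).card * (MvPolynomial.X a * α (insert a T))
  map_add' α β := by
    funext T
    simp only [Pi.add_apply, mul_add, Finset.sum_add_distrib]
  map_smul' c α := by
    funext T
    simp only [Pi.smul_apply, smul_eq_mul, RingHom.id_apply, Finset.mul_sum]
    exact Finset.sum_congr rfl fun a _ => by ring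

/-- The `k`-vector space `(⋀^{n-2} V ⊗ I(X)_2) ∩ K_{n-2}`, where `K_{n-2}` is the kernel of the
Koszul differential on `⋀^{n-2} V ⊗ R`: families of quadratic forms of `I(X)`, indexed by the
subsets with `n - 2` elements of `{0, …, n}`, which are annihilated by the Koszul differential. -/
def koszulCycles {k : Type*} [Field k] {n : ℕ}
    (e : Module.Basis (Fin (n + 1)) k (Fin (n + 1) → k))
    (X : Finset (ℙ k (Fin (n + 1) → k))) :
    Submodule k (Finset (Fin (n + 1)) → MvPolynomial (Fin (n + 1)) k) where
  carrier := {α | (∀ J, α J ∈ definingIdeal e X ∧ (α J).IsHomogeneous 2) ∧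
    (∀ J, J.card ≠ n - 2 → α J = 0) ∧ koszulDiff k n α = 0}
  add_mem' := by
    rintro α β ⟨h1, h2, h3⟩ ⟨g1, g2, g3⟩
    refine ⟨fun J => ⟨Ideal.add_mem _ (h1 J).1 (g1 J).1, (h1 J).2.add (g1 J).2⟩,
      fun J hJ => ?_, ?_⟩
    · simp [h2 J hJ, g2 J hJ]
    · rw [map_add, h3, g3, add_zero]
  zero_mem' :=
    ⟨fun _ => ⟨Ideal.zero_mem _, MvPolynomial.isHomogeneous_zero _ _ _⟩, fun _ _ => rfl, map_zero _⟩
  smul_mem' := by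
    rintro c α ⟨h1, h2, h3⟩
    have hc : c • α = (MvPolynomial.C c : MvPolynomial (Fin (n + 1)) k) • α := by
      funext J
      simp [MvPolynomial.smul_eq_C_mul]
    refine ⟨fun J => ⟨?_, ?_⟩, fun J hJ => ?_, ?_⟩
    · rw [Pi.smul_apply, MvPolynomial.smul_eq_C_mul]
      exact Ideal.mul_mem_left _ _ (h1 J).1
    · rw [Pi.smul_apply, MvPolynomial.smul_eq_C_mul]
      exact (h1 J).2.C_mul c
    · simp [h2 J hJ]
    · rw [hc, map_smul, h3, smul_zero]

/-- The quadric `F_{abc}` of `α = ∑_J ε_J ⊗ α_J`: the coefficient `α_J` at the complement `J` of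
`{a, b, c}`. -/
def specialQuadric {k : Type*} [Field k] {n : ℕ}
    (α : Finset (Fin (n + 1)) → MvPolynomial (Fin (n + 1)) k) (a b c : Fin (n + 1)) :
    MvPolynomial (Fin (n + 1)) k :=
  α ({a, b, c} : Finset (Fin (n + 1)))ᶜ

/-- The vector space `W_j` spanned by the linear forms `L^j_{ab}`, `0 ≤ a < b ≤ n - i - 1`, which
are determined by `F_{abj} = x_j L^j_{ab}`. -/
def spaceW {k : Type*} [Field k] {n : ℕ} (i : ℕ)
    (α : Finset (Fin (n + 1)) → MvPolynomial (Fin (n + 1)) k) (j : Fin (n + 1)) :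
    Submodule k (MvPolynomial (Fin (n + 1)) k) :=
  Submodule.span k {L | L.IsHomogeneous 1 ∧ ∃ a b : Fin (n + 1), a < b ∧ (b : ℕ) ≤ n - i - 1 ∧
    specialQuadric α a b j = MvPolynomial.X j * L}

end

/-! All coordinate points lie in `X`, so no quadric in `I_2` has a square term. The Koszul relations
then force the signed `F_{abc}` to involve only `x_a, x_b, x_c`, and make its `x_a x_b` coefficient
a cocycle in `a, b` for fixed `c`. Hence there is a matrix `p`, with each column free up to an
additive constant, such that `F_{abc} = (p_bc - p_ac) x_a x_b + (p_ab - p_cb) x_a x_c + (p_ca -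
p_ba) x_b x_c` (`signedQuadric_eq`, `potential_sub`).

Let `A = {0, …, n-i-1}`. The column constants are chosen so that row `j` vanishes on `A` and `p_0l =
0` for `l ∉ A`. The extra point of `X` in the plane of `A` then gives `p_al = 0` for all `a ∈ A`, `l
∉ A`. Now `L^j_ab` is `p_ab x_a - p_ba x_b` up to sign, so `dim W_j ≥ |A| - 1` says that these
binomials have at most one common zero on `A`, up to scalars (`finrank_span_binomials_add_two_le`).
A point of `X` with a nonzero coordinate at any index whose row vanishes on `A` has its `A`-part on
this line.

The core is `exists_separating_indices`: there are a nonempty `K` disjoint from `A` and a vector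
`u`, nonzero on `A`, such that every point of `X` vanishes on `K` or is a multiple of `u` off `K`.
In the main case `u` comes from a point of `X`, and `K` is a closure: indices of zero rows where
points deviate from `u`, then every index outside `A` with a nonzero entry of `p` into the set. The
span of `e_l`, `l ∉ K`, and the span of `u` and `e_l`, `l ∈ K`, give projective dimensions `n - |K|`
and `|K|`. -/

/-- The values at `z` of the quadrics `F_{abc}` attached to a matrix `p` vanish. -/
def IsEigenpoint {k ι : Type*} [Field k] (p : ι → ι → k) (z : ι → k) : Prop :=
  ∀ a b c, a ≠ b → a ≠ c → b ≠ c →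
    (p b c - p a c) * z a * z b + (p a b - p c b) * z a * z c + (p c a - p b a) * z b * z c = 0

/-- Indices outside `A` whose row of `p` vanishes on `A`. -/
def ZeroRow {k ι : Type*} [Field k] (A : Set ι) (p : ι → ι → k) (l : ι) : Prop :=
  l ∉ A ∧ ∀ a ∈ A, p l a = 0

/-- The indices reached from `j` by deviations of points of `Z` from the point `u`. -/
inductive Deviates {k ι : Type*} [Field k] (A : Set ι) (p : ι → ι → k) (Z : Set (ι → k))
    (u : ι → k) (j : ι) : ι → Prop
  | base : Deviates A p Z u j j
  | step {c l : ι} (z : ι → k) (ζ : k) : Deviates A p Z u j c → z ∈ Z → z c ≠ 0 →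
      ZeroRow A p l → (∀ a ∈ A, z a = ζ * u a) → z l ≠ ζ * u l → Deviates A p Z u j l

/-- The indices outside `A` from which `J` can be reached along nonzero entries of `p`. -/
inductive Reaches {k ι : Type*} [Field k] (A : Set ι) (p : ι → ι → k) (J : ι → Prop) : ι → Prop
  | base {l : ι} : J l → Reaches A p J l
  | step {c l : ι} : Reaches A p J c → l ∉ A → p l c ≠ 0 → Reaches A p J l

/-! ### Common zeros of the quadrics, and their separation. -/

section Eigenpoints

variable {k ι : Type*} [Field k] {A : Set ι} {p : ι → ι → k} {z : ι → k}

/-- For a zero row `l`, the quadric `F_{abl}` is `x_l (p_ab x_a - p_ba x_b)`. -/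
theorem IsEigenpoint.line_eq (hz : IsEigenpoint p z) (hAB : ∀ a ∈ A, ∀ l ∉ A, p a l = 0)
    {a b l : ι} (ha : a ∈ A) (hb : b ∈ A) (hab : a ≠ b) (hl : ZeroRow A p l) (hzl : z l ≠ 0) :
    p a b * z a = p b a * z b := by
  have h := hz a b l hab (fun h => hl.1 (h ▸ ha)) (fun h => hl.1 (h ▸ hb))
  rw [hAB a ha l hl.1, hAB b hb l hl.1, hl.2 a ha, hl.2 b hb] at h
  have : z l * (p a b * z a - p b a * z b) = 0 := by linear_combination h
  exact sub_eq_zero.1 ((mul_eq_zero.1 this).resolve_left hzl)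

theorem IsEigenpoint.mixed_eq (hz : IsEigenpoint p z) (hAB : ∀ a ∈ A, ∀ l ∉ A, p a l = 0)
    {a l l' : ι} (ha : a ∈ A) (hl : l ∉ A) (hl' : l' ∉ A) (hll : l ≠ l') :
    p l l' * z a * z l - p l' l * z a * z l' + (p l' a - p l a) * z l * z l' = 0 := by
  have h := hz a l l' (fun h => hl (h ▸ ha)) (fun h => hl' (h ▸ ha)) hll
  rw [hAB a ha l hl, hAB a ha l' hl'] at h
  linear_combination h

theorem IsEigenpoint.entry_eq_zero (hz : IsEigenpoint p z) (hAB : ∀ a ∈ A, ∀ l ∉ A, p a l = 0)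
    {a l c : ι} (ha : a ∈ A) (hza : z a ≠ 0) (hl : l ∉ A) (hzl : z l ≠ 0) (hc : c ∉ A)
    (hzc : z c = 0) : p l c = 0 := by
  have h := hz.mixed_eq hAB ha hl hc (fun h => hzl (h ▸ hzc))
  rw [hzc] at h
  simpa [hza, hzl] using h

/-- If `z` vanishes on `A`, only the `x_l x_l'` term of `F_{all'}` survives at `z`. -/
theorem IsEigenpoint.row_eq (hz : IsEigenpoint p z) (hAB : ∀ a ∈ A, ∀ l ∉ A, p a l = 0)
    (hzA : ∀ a ∈ A, z a = 0) {l l' a : ι} (hzl : z l ≠ 0) (hzl' : z l' ≠ 0) (ha : a ∈ A) :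
    p l' a = p l a := by
  by_cases hll : l = l'
  · rw [hll]
  have h := hz.mixed_eq hAB ha (fun h => hzl (hzA l h)) (fun h => hzl' (hzA l' h)) hll
  rw [hzA a ha] at h
  have h2 : (p l' a - p l a) * (z l * z l') = 0 := by linear_combination h
  exact sub_eq_zero.1 ((mul_eq_zero.1 h2).resolve_right (mul_ne_zero hzl hzl'))

theorem IsEigenpoint.column_eq (hz : IsEigenpoint p z) {l l' c : ι} (hzl : z l ≠ 0)
    (hzl' : z l' ≠ 0) (hzc : z c = 0) : p l' c = p l c := by
  by_cases hll : l = l'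
  · rw [hll]
  have h := hz l l' c hll (fun h => hzl (h ▸ hzc)) (fun h => hzl' (h ▸ hzc))
  rw [hzc] at h
  have h2 : (p l' c - p l c) * (z l * z l') = 0 := by linear_combination h
  exact sub_eq_zero.1 ((mul_eq_zero.1 h2).resolve_right (mul_ne_zero hzl hzl'))

theorem IsEigenpoint.zeroRow_balance (hz : IsEigenpoint p z)
    (hAB : ∀ a ∈ A, ∀ l ∉ A, p a l = 0) {a c l : ι} (ha : a ∈ A) (hza : z a ≠ 0)
    (hc : ZeroRow A p c) (hl : ZeroRow A p l) : p c l * z c = p l c * z l := by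
  by_cases hcl : c = l
  · rw [hcl]
  have h := hz.mixed_eq hAB ha hc.1 hl.1 hcl
  rw [hc.2 a ha, hl.2 a ha] at h
  have h2 : z a * (p c l * z c - p l c * z l) = 0 := by linear_combination h
  exact sub_eq_zero.1 ((mul_eq_zero.1 h2).resolve_left hza)

/-- At `z`, `F_{cld}` is `(p_ld - p_cd) z_c z_l + z_d (p_cl z_c - p_lc z_l)`. The second summand
vanishes: by `zeroRow_balance` if `z` is nonzero somewhere on `A`, and otherwise because `row_eq`
forces `z_d = 0`. -/
theorem IsEigenpoint.entry_eq_of_zeroRow (hz : IsEigenpoint p z)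
    (hAB : ∀ a ∈ A, ∀ l ∉ A, p a l = 0) {c l d : ι} (hc : ZeroRow A p c) (hl : ZeroRow A p l)
    (hd : d ∉ A) (hd' : ¬ ZeroRow A p d) (hdc : p d c = 0) (hdl : p d l = 0)
    (hzc : z c ≠ 0) (hzl : z l ≠ 0) : p l d = p c d := by
  by_cases hcl : c = l
  · rw [hcl]
  have h := hz c l d hcl (fun h => hd' (h ▸ hc)) (fun h => hd' (h ▸ hl))
  rw [hdc, hdl] at h
  have h1 : z d * (p c l * z c - p l c * z l) = 0 := by
    by_cases hzA : ∀ a ∈ A, z a = 0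
    · have : z d = 0 := by
        by_contra hzd
        exact hd' ⟨hd, fun a ha => by rw [hz.row_eq hAB hzA hzc hzd ha, hc.2 a ha]⟩
      rw [this, zero_mul]
    · push Not at hzA
      obtain ⟨a, ha, hza⟩ := hzA
      rw [hz.zeroRow_balance hAB ha hza hc hl, sub_self, mul_zero]
  have h2 : (p l d - p c d) * (z c * z l) = 0 := by linear_combination h - h1
  exact sub_eq_zero.1 ((mul_eq_zero.1 h2).resolve_right (mul_ne_zero hzc hzl))

variable {Z : Set (ι → k)} {u : ι → k} {j : ι}

theorem Deviates.zeroRow (hj : ZeroRow A p j) {l : ι} (h : Deviates A p Z u j l) :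
    ZeroRow A p l := by
  cases h with
  | base => exact hj
  | step z ζ _ _ _ h _ _ => exact h

theorem Reaches.notMem {J : ι → Prop} (hJ : ∀ l, J l → l ∉ A) {l : ι} (h : Reaches A p J l) :
    l ∉ A := by
  cases h with
  | base h => exact hJ _ h
  | step _ h _ => exact h

theorem entry_eq_zero_of_not_reaches {J : ι → Prop} {d c : ι} (hd : d ∉ A)
    (hdK : ¬ Reaches A p J d) (hc : Reaches A p J c) : p d c = 0 := by
  by_contra h
  exact hdK (.step hc hd h)

/-- Induction along the deviations. If `u_l = 0`, the deviating point `z` is nonzero at both `c` and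
`l` and compares these two rows; if `u_l ≠ 0`, the point `u` compares row `l` with row `j` directly.
-/
theorem Deviates.entry_eq (hZ : ∀ z ∈ Z, IsEigenpoint p z)
    (hAB : ∀ a ∈ A, ∀ l ∉ A, p a l = 0) (hj : ZeroRow A p j) (hu : u ∈ Z) (huj : u j ≠ 0)
    {d : ι} (hd : d ∉ A) (hd' : ¬ ZeroRow A p d) (hdK : ¬ Reaches A p (Deviates A p Z u j) d)
    {c : ι} (hc : Deviates A p Z u j c) : p c d = p j d := by
  induction hc with
  | base => rfl
  | @step c l z ζ hc hz hzc hl hza hzl ih =>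
    have hlJ : Deviates A p Z u j l := .step z ζ hc hz hzc hl hza hzl
    have hdl := entry_eq_zero_of_not_reaches hd hdK (.base hlJ)
    by_cases hul : u l = 0
    · rw [hul, mul_zero] at hzl
      rw [← ih]
      exact (hZ z hz).entry_eq_of_zeroRow hAB (hc.zeroRow hj) hl hd hd'
        (entry_eq_zero_of_not_reaches hd hdK (.base hc)) hdl hzc hzl
    · exact (hZ u hu).entry_eq_of_zeroRow hAB hj hl hd hd'
        (entry_eq_zero_of_not_reaches hd hdK (.base .base)) hdl huj hul

/-- By `entry_eq_zero`, the support of `z` outside `A` propagates along nonzero entries of `p`,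
hence back to `J`. -/
theorem IsEigenpoint.exists_ne_zero_of_reaches (hz : IsEigenpoint p z)
    (hAB : ∀ a ∈ A, ∀ l ∉ A, p a l = 0) {J : ι → Prop} (hJ : ∀ l, J l → l ∉ A)
    {a : ι} (ha : a ∈ A) (hza : z a ≠ 0) {l : ι} (hl : Reaches A p J l) (hzl : z l ≠ 0) :
    ∃ c, J c ∧ z c ≠ 0 := by
  induction hl with
  | base h => exact ⟨_, h, hzl⟩
  | @step c l hc hlA hlc ih =>
    exact ih fun hzc => hlc (hz.entry_eq_zero hAB ha hza hlA hzl (hc.notMem hJ) hzc)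

theorem IsEigenpoint.reaches_of_ne_zero (hz : IsEigenpoint p z) (hzZ : z ∈ Z)
    (hAB : ∀ a ∈ A, ∀ l ∉ A, p a l = 0) (hj : ZeroRow A p j) (hzA : ∀ a ∈ A, z a = 0) {l l' : ι}
    (hl : Reaches A p (Deviates A p Z u j) l) (hzl : z l ≠ 0) (hzl' : z l' ≠ 0) :
    Reaches A p (Deviates A p Z u j) l' := by
  have hl'A : l' ∉ A := fun h => hzl' (hzA l' h)
  induction hl with
  | @base c h =>
    -- As `z` vanishes on `A`, it is compared with `0 • u`, so each nonzero coordinate at a zero row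
    -- is a deviation.
    refine .base (.step z 0 h hzZ hzl ⟨hl'A, fun a ha => ?_⟩ ?_ ?_)
    · rw [hz.row_eq hAB hzA hzl hzl' ha, (h.zeroRow hj).2 a ha]
    · simpa using hzA
    · simpa using hzl'
  | @step c l hc hlA hlc ih =>
    by_cases hzc : z c = 0
    · exact .step hc hl'A (by rwa [hz.column_eq hzl hzl' hzc])
    · exact ih hzc

/-- Points at which all `F_{abc}` vanish are separated by a coordinate subspace. -/
theorem exists_separating_indices [Finite ι] (hZ : ∀ z ∈ Z, IsEigenpoint p z)
    (hA : A.Nonempty) (hAB : ∀ a ∈ A, ∀ l ∉ A, p a l = 0) (hj : ZeroRow A p j)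
    (hrank : ∀ v w : ι → k, (∃ a ∈ A, v a ≠ 0) →
      (∀ a ∈ A, ∀ b ∈ A, a ≠ b → p a b * v a = p b a * v b) →
      (∀ a ∈ A, ∀ b ∈ A, a ≠ b → p a b * w a = p b a * w b) →
      ∃ ζ, ∀ a ∈ A, w a = ζ * v a) :
    ∃ (K : Finset ι) (u : ι → k), K.Nonempty ∧ (∀ l ∈ K, l ∉ A) ∧ (∃ a ∈ A, u a ≠ 0) ∧
      ∀ z ∈ Z, (∀ l ∈ K, z l = 0) ∨ ∃ ζ, ∀ l ∉ K, z l = ζ * u l := by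
  classical
  have := Fintype.ofFinite ι
  -- If no point is nonzero both at a zero row and on `A`, then `K` is the set of all zero rows; the
  -- multiplier is always `0`, so any `u` nonzero on `A` will do.
  by_cases hI : ∀ z ∈ Z, ∀ l, ZeroRow A p l → z l ≠ 0 → ∀ a ∈ A, z a = 0
  · obtain ⟨a₀, ha₀⟩ := hA
    refine ⟨Finset.univ.filter (ZeroRow A p), Pi.single a₀ 1, ⟨j, by simpa using hj⟩,
      fun l hl => (Finset.mem_filter.1 hl).2.1, ⟨a₀, ha₀, by simp⟩, fun z hz => ?_⟩
    by_cases h0 : ∀ l, ZeroRow A p l → z l = 0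
    · exact .inl fun l hl => h0 l (Finset.mem_filter.1 hl).2
    push Not at h0
    obtain ⟨l, hl, hzl⟩ := h0
    have hzA := hI z hz l hl hzl
    refine .inr ⟨0, fun l' hl' => ?_⟩
    rw [zero_mul]
    by_contra hzl'
    refine hl' (Finset.mem_filter.2 ⟨Finset.mem_univ _, fun h => hzl' (hzA l' h), fun a ha => ?_⟩)
    rw [(hZ z hz).row_eq hAB hzA hzl hzl' ha, hl.2 a ha]
  · push Not at hI
    obtain ⟨u, hu, i, hi, hui, a₀, ha₀, hua₀⟩ := hI
    have hJ : ∀ l, Deviates A p Z u i l → l ∉ A := fun l h => (h.zeroRow hi).1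
    refine ⟨Finset.univ.filter (Reaches A p (Deviates A p Z u i)), u,
      ⟨i, by simpa using .base .base⟩,
      fun l hl => (Finset.mem_filter.1 hl).2.notMem hJ, ⟨a₀, ha₀, hua₀⟩, fun z hz => ?_⟩
    simp only [Finset.mem_filter, Finset.mem_univ, true_and]
    by_cases h0 : ∀ l, Reaches A p (Deviates A p Z u i) l → z l = 0
    · exact .inl h0
    push Not at h0
    obtain ⟨l, hl, hzl⟩ := h0
    right
    by_cases hzA : ∀ a ∈ A, z a = 0
    · refine ⟨0, fun l' hl' => ?_⟩
      rw [zero_mul]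
      by_contra hzl'
      exact hl' ((hZ z hz).reaches_of_ne_zero hz hAB hi hzA hl hzl hzl')
    push Not at hzA
    obtain ⟨a, ha, hza⟩ := hzA
    obtain ⟨c, hc, hzc⟩ := (hZ z hz).exists_ne_zero_of_reaches hAB hJ ha hza hl hzl
    have hcr := hc.zeroRow hi
    -- Both `u` and `z` are nonzero at a zero row, so their `A`-parts lie on the same line.
    obtain ⟨ζ, hζ⟩ := hrank u z ⟨a₀, ha₀, hua₀⟩
      (fun a ha b hb hab => (hZ u hu).line_eq hAB ha hb hab hi hui)
      (fun a ha b hb hab => (hZ z hz).line_eq hAB ha hb hab hcr hzc)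
    refine ⟨ζ, fun d hd => ?_⟩
    by_cases hdA : d ∈ A
    · exact hζ d hdA
    by_cases hdr : ZeroRow A p d
    · by_contra hne
      exact hd (.base (.step z ζ hc hz hzc hdr hζ hne))
    obtain ⟨b, hb, hdb⟩ : ∃ b ∈ A, p d b ≠ 0 := by
      by_contra h
      push Not at h
      exact hdr ⟨hdA, h⟩
    -- With `p_dc = 0` and `p_cb = 0`, the equation `F_{bcd} = 0` determines `w_d` from `w_b`, since
    -- `p_db ≠ 0`. By `Deviates.entry_eq` the coefficient `p_cd` is the same for `z` and `u`.
    have key : ∀ w ∈ Z, ∀ c, Deviates A p Z u i c → w c ≠ 0 → p c d * w b = - (p d b * w d) := by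
      intro w hw c hc hwc
      have hcr := hc.zeroRow hi
      have h := (hZ w hw).mixed_eq hAB hb hcr.1 hdA (fun h => hdr (h ▸ hcr))
      rw [entry_eq_zero_of_not_reaches hdA hd (.base hc), hcr.2 b hb] at h
      have h2 : w c * (p c d * w b + p d b * w d) = 0 := by linear_combination h
      exact eq_neg_of_add_eq_zero_left ((mul_eq_zero.1 h2).resolve_left hwc)
    have h1 := key z hz c hc hzc
    have h2 := key u hu i .base hui
    rw [hc.entry_eq hZ hAB hi hu hui hdA hdr hd, hζ b hb] at h1
    have h3 : p d b * (z d - ζ * u d) = 0 := by linear_combination h1 - ζ * h2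
    exact sub_eq_zero.1 ((mul_eq_zero.1 h3).resolve_left hdb)

end Eigenpoints

/-! ### Coefficients of quadratic forms. -/

theorem Finsupp.exists_eq_single_add_of_degree_eq_succ {σ : Type*} {m : σ →₀ ℕ} {d : ℕ}
    (hm : m.degree = d + 1) : ∃ s m', m = Finsupp.single s 1 + m' ∧ m'.degree = d := by
  have h0 : m ≠ 0 := by
    rintro rfl
    simp at hm
  obtain ⟨s, hs⟩ := Finsupp.ne_iff.1 h0
  have h1 : Finsupp.single s 1 ≤ m := by
    rw [Finsupp.single_le_iff]
    exact Nat.one_le_iff_ne_zero.2 hs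
  refine ⟨s, m - Finsupp.single s 1, (add_tsub_cancel_of_le h1).symm, ?_⟩
  have := congrArg Finsupp.degree (add_tsub_cancel_of_le h1)
  rw [map_add, Finsupp.degree_single] at this
  omega

open MvPolynomial in
/-- Quadratic forms without square terms which are supported on the variables `a, b, c`. -/
theorem MvPolynomial.eq_of_isHomogeneous_two {σ k : Type*} [Field k]
    {f : MvPolynomial σ k} (hf : f.IsHomogeneous 2) {a b c : σ} (hab : a ≠ b) (hac : a ≠ c)
    (hbc : b ≠ c)
    (hsq : ∀ s, coeff (Finsupp.single s 1 + Finsupp.single s 1) f = 0)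
    (hout : ∀ s t, s ≠ a → s ≠ b → s ≠ c →
      coeff (Finsupp.single s 1 + Finsupp.single t 1) f = 0) :
    f = C (coeff (Finsupp.single a 1 + Finsupp.single b 1) f) * (X a * X b) +
      C (coeff (Finsupp.single a 1 + Finsupp.single c 1) f) * (X a * X c) +
      C (coeff (Finsupp.single b 1 + Finsupp.single c 1) f) * (X b * X c) := by
  classical
  have hmon : ∀ s t : σ, (X s * X t : MvPolynomial σ k) =
      monomial (Finsupp.single s 1 + Finsupp.single t 1) 1 := fun s t => by
    rw [X, X, monomial_mul, one_mul]
  have hcoeff : ∀ s t : σ, coeff (Finsupp.single s 1 + Finsupp.single t 1) f =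
      coeff (Finsupp.single s 1 + Finsupp.single t 1)
      (C (coeff (Finsupp.single a 1 + Finsupp.single b 1) f) * (X a * X b) +
      C (coeff (Finsupp.single a 1 + Finsupp.single c 1) f) * (X a * X c) +
      C (coeff (Finsupp.single b 1 + Finsupp.single c 1) f) * (X b * X c)) := by
    have hout' : ∀ s t, t ≠ a → t ≠ b → t ≠ c →
        coeff (Finsupp.single s 1 + Finsupp.single t 1) f = 0 := fun s t h1 h2 h3 => by
      rw [add_comm, hout t s h1 h2 h3]
    intro s t
    simp only [hmon, coeff_add, coeff_C_mul, coeff_monomial,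
      Finsupp.single_add_single_eq_single_add_single (one_ne_zero (α := ℕ)) one_ne_zero]
    by_cases hs : s ≠ a ∧ s ≠ b ∧ s ≠ c
    · simp [hout s t hs.1 hs.2.1 hs.2.2, hs.1.symm, hs.2.1.symm, hs.2.2.symm]
    by_cases ht : t ≠ a ∧ t ≠ b ∧ t ≠ c
    · simp [hout' s t ht.1 ht.2.1 ht.2.2, ht.1.symm, ht.2.1.symm, ht.2.2.symm]
    have hs' : s = a ∨ s = b ∨ s = c := by tauto
    have ht' : t = a ∨ t = b ∨ t = c := by tauto
    clear hout hout' hs ht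
    rcases hs' with rfl | rfl | rfl <;> rcases ht' with rfl | rfl | rfl <;>
      simp [hsq, hab, hac, hbc, hab.symm, hac.symm, hbc.symm, add_comm]
  have hg : (C (coeff (Finsupp.single a 1 + Finsupp.single b 1) f) * (X a * X b) +
      C (coeff (Finsupp.single a 1 + Finsupp.single c 1) f) * (X a * X c) +
      C (coeff (Finsupp.single b 1 + Finsupp.single c 1) f) * (X b * X c)).IsHomogeneous 2 := by
    refine IsHomogeneous.add (IsHomogeneous.add ?_ ?_) ?_ <;>
    exact ((isHomogeneous_X k _).mul (isHomogeneous_X k _)).C_mul _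
  ext m
  by_cases hm : m.degree = 2
  · obtain ⟨s, t, rfl⟩ : ∃ s t, m = Finsupp.single s 1 + Finsupp.single t 1 := by
      obtain ⟨s, m', rfl, hm'⟩ := Finsupp.exists_eq_single_add_of_degree_eq_succ hm
      obtain ⟨t, m'', rfl, hm''⟩ := Finsupp.exists_eq_single_add_of_degree_eq_succ hm'
      exact ⟨s, t, by rw [(Finsupp.degree_eq_zero_iff _).1 hm'', add_zero]⟩
    exact hcoeff s t
  · rw [hf.coeff_eq_zero hm, hg.coeff_eq_zero hm]

/-- At a multiple of the coordinate point of `s`, every quadratic monomial other than the square of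
`x_s` vanishes. -/
theorem MvPolynomial.coeff_single_add_single_self_eq_zero {σ k : Type*} [Field k]
    {f : MvPolynomial σ k} (hf : f.IsHomogeneous 2) {s : σ} {z : σ → k}
    (hzs : z s ≠ 0) (hz : ∀ t, t ≠ s → z t = 0) (h : eval z f = 0) :
    coeff (Finsupp.single s 1 + Finsupp.single s 1) f = 0 := by
  classical
  rw [eval_eq, Finset.sum_eq_single (Finsupp.single s 1 + Finsupp.single s 1)] at h
  · refine (mul_eq_zero.1 h).resolve_right (Finset.prod_ne_zero_iff.2 fun i hi => ?_)
    have : i = s := by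
      by_contra hne
      simp [Ne.symm hne] at hi
    rw [this]
    exact pow_ne_zero _ hzs
  · intro m hm hne
    have hdeg : m.degree = 2 := by
      by_contra hd
      exact (mem_support_iff.1 hm) (hf.coeff_eq_zero hd)
    obtain ⟨t, ht, hts⟩ : ∃ t ∈ m.support, t ≠ s := by
      by_contra hall
      push Not at hall
      apply hne
      have h1 : m = Finsupp.single s (m s) := by
        ext t
        by_cases hts : t = s
        · rw [hts]; simp
        · rw [Finsupp.single_eq_of_ne hts]
          by_contra h0
          exact hts (hall t (Finsupp.mem_support_iff.2 h0))
      rw [h1, Finsupp.degree_single] at hdeg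
      rw [h1, hdeg, ← Finsupp.single_add]
    rw [Finset.prod_eq_zero ht, mul_zero]
    rw [hz t hts, zero_pow (Finsupp.mem_support_iff.1 ht)]
  · intro hm
    rw [notMem_support_iff.1 hm, zero_mul]

/-! ### Signs and the Koszul relations. -/

noncomputable section

open MvPolynomial

/-- The sign of the permutation that sorts two indices; it is zero if they agree. -/
def pairSign {N : ℕ} (a b : Fin N) : ℤ :=
  if b < a then -1 else if a < b then 1 else 0

theorem pairSign_self {N : ℕ} (a : Fin N) : pairSign a a = 0 := by
  simp [pairSign]

theorem pairSign_swap {N : ℕ} (a b : Fin N) : pairSign b a = -pairSign a b := by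
  unfold pairSign
  rcases lt_trichotomy a b with h | rfl | h
  · simp [h, h.not_gt]
  · simp
  · simp [h, h.not_gt]

theorem pairSign_sq {N : ℕ} {a b : Fin N} (h : a ≠ b) : pairSign a b ^ 2 = 1 := by
  unfold pairSign
  rcases lt_or_gt_of_ne h with h | h
  · simp [h, h.not_gt]
  · simp [h]

theorem pairSign_of_ne {N : ℕ} {a b : Fin N} (h : a ≠ b) :
    pairSign a b = if b < a then -1 else 1 := by
  unfold pairSign
  rcases lt_or_gt_of_ne h with h | h
  · simp [h, h.not_gt]
  · simp [h]

/-- The number of elements below `t` in the complement of a four-element set, up to parity. -/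
theorem neg_one_pow_card_filter_compl {N : ℕ} {t b c d : Fin N} (htb : t ≠ b) (htc : t ≠ c)
    (htd : t ≠ d) (hbc : b ≠ c) (hbd : b ≠ d) (hcd : c ≠ d) :
    (-1 : ℤ) ^ ((({t, b, c, d} : Finset (Fin N))ᶜ).filter (fun s => s < t)).card =
      (-1) ^ (t : ℕ) * (pairSign t b * pairSign t c * pairSign t d) := by
  have h1 : (-1 : ℤ) ^ (({t, b, c, d} : Finset (Fin N)).filter (fun s => s < t)).card =
      pairSign t b * pairSign t c * pairSign t d := by
    rw [pairSign_of_ne htb, pairSign_of_ne htc, pairSign_of_ne htd, ← Finset.prod_const,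
      Finset.prod_filter]
    simp [Finset.prod_insert, htb, htc, htd, hbc, hbd, hcd]
  have h2 : (({t, b, c, d} : Finset (Fin N)).filter (fun s => s < t)).card +
      ((({t, b, c, d} : Finset (Fin N))ᶜ).filter (fun s => s < t)).card = t := by
    rw [← Finset.card_union_of_disjoint, ← Finset.filter_union, Finset.union_compl,
      Finset.filter_gt_eq_Iio, Fin.card_Iio]
    exact Finset.disjoint_filter_filter disjoint_compl_right
  rw [← h1, ← pow_add, ← h2]
  generalize (({t, b, c, d} : Finset (Fin N)).filter (fun s => s < t)).card = p
  rw [show ∀ q, p + q + p = q + 2 * p by intro q; ring, pow_add, pow_mul]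
  simp

variable {k : Type*} [Field k] {n : ℕ}

/-- The quadric `F_{abc}` with the sign that makes it alternating in its indices and that turns the
Koszul relations into standard form. -/
def signedQuadric (α : Finset (Fin (n + 1)) → MvPolynomial (Fin (n + 1)) k)
    (a b c : Fin (n + 1)) : MvPolynomial (Fin (n + 1)) k :=
  (((-1) ^ (a + b + c : ℕ) * (pairSign a b * pairSign a c * pairSign b c) : ℤ) :
    MvPolynomial (Fin (n + 1)) k) * specialQuadric α a b c

variable {α : Finset (Fin (n + 1)) → MvPolynomial (Fin (n + 1)) k}

theorem signedQuadric_swap_left (a b c : Fin (n + 1)) :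
    signedQuadric α b a c = -signedQuadric α a b c := by
  unfold signedQuadric specialQuadric
  rw [Finset.insert_comm b a, pairSign_swap a b, add_comm (b : ℕ) a]
  push_cast
  ring

theorem signedQuadric_swap_right (a b c : Fin (n + 1)) :
    signedQuadric α a c b = -signedQuadric α a b c := by
  unfold signedQuadric specialQuadric
  rw [Finset.pair_comm c b, pairSign_swap b c, add_right_comm]
  push_cast
  ring

theorem signedQuadric_self (a c : Fin (n + 1)) : signedQuadric α a a c = 0 := by
  simp [signedQuadric, pairSign_self]

theorem signedQuadric_relation (hα : koszulDiff k n α = 0) {a b c d : Fin (n + 1)} (hab : a ≠ b)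
    (hac : a ≠ c) (had : a ≠ d) (hbc : b ≠ c) (hbd : b ≠ d) (hcd : c ≠ d) :
    X a * signedQuadric α b c d - X b * signedQuadric α a c d + X c * signedQuadric α a b d
      - X d * signedQuadric α a b c = 0 := by
  have hterm : ∀ t x y z : Fin (n + 1), t ≠ x → t ≠ y → t ≠ z → x ≠ y → x ≠ z → y ≠ z →
      (-1 : MvPolynomial (Fin (n + 1)) k) ^
        ((({t, x, y, z} : Finset (Fin (n + 1)))ᶜ).filter (fun s => s < t)).card *
        (X t * α (insert t ({t, x, y, z} : Finset (Fin (n + 1)))ᶜ)) =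
      (((-1) ^ (t : ℕ) * (pairSign t x * pairSign t y * pairSign t z) : ℤ) :
        MvPolynomial (Fin (n + 1)) k) * (X t * specialQuadric α x y z) := by
    intro t x y z h1 h2 h3 h4 h5 h6
    rw [← neg_one_pow_card_filter_compl h1 h2 h3 h4 h5 h6, ← Finset.compl_erase,
      Finset.erase_insert (by simp [h1, h2, h3]), specialQuadric]
    push_cast
    rfl
  have h := congrFun hα ({a, b, c, d} : Finset (Fin (n + 1)))ᶜ
  simp only [koszulDiff, LinearMap.coe_mk, AddHom.coe_mk, Pi.zero_apply, compl_compl] at h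
  rw [Finset.sum_insert (by simp [hab, hac, had]), Finset.sum_insert (by simp [hbc, hbd]),
    Finset.sum_insert (by simp [hcd]), Finset.sum_singleton, hterm a b c d hab hac had hbc hbd hcd,
    Finset.insert_comm a b, hterm b a c d hab.symm hbc hbd hac had hcd,
    Finset.insert_comm a c, Finset.insert_comm b c,
    hterm c b a d hbc.symm hac.symm hcd hab.symm hbd had,
    Finset.pair_comm a d, Finset.insert_comm b d, Finset.insert_comm c d,
    hterm d c b a hcd.symm hbd.symm had.symm hbc.symm hac.symm hab.symm] at h
  rw [show specialQuadric α b a d = specialQuadric α a b d by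
      rw [specialQuadric, Finset.insert_comm]; rfl,
    show specialQuadric α c b a = specialQuadric α a b c by
      rw [specialQuadric, Finset.insert_comm, Finset.pair_comm c a, Finset.insert_comm]; rfl] at h
  simp only [signedQuadric]
  rw [pairSign_swap a b, pairSign_swap a c, pairSign_swap a d, pairSign_swap b c,
    pairSign_swap b d, pairSign_swap c d] at h
  have e1 := pairSign_sq hab
  have e2 := pairSign_sq hac
  have e3 := pairSign_sq had
  have e4 := pairSign_sq hbc
  have e5 := pairSign_sq hbd
  have e6 := pairSign_sq hcd
  have ha : ((-1 : ℤ) ^ (a : ℕ)) ^ 2 = 1 := by rw [← pow_mul, mul_comm, pow_mul]; simp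
  have hb : ((-1 : ℤ) ^ (b : ℕ)) ^ 2 = 1 := by rw [← pow_mul, mul_comm, pow_mul]; simp
  have hc : ((-1 : ℤ) ^ (c : ℕ)) ^ 2 = 1 := by rw [← pow_mul, mul_comm, pow_mul]; simp
  have hd : ((-1 : ℤ) ^ (d : ℕ)) ^ 2 = 1 := by rw [← pow_mul, mul_comm, pow_mul]; simp
  simp only [pow_add] at h ⊢
  generalize (-1 : ℤ) ^ (a : ℕ) = sa at *
  generalize (-1 : ℤ) ^ (b : ℕ) = sb at *
  generalize (-1 : ℤ) ^ (c : ℕ) = sc at *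
  generalize (-1 : ℤ) ^ (d : ℕ) = sd at *
  generalize pairSign a b = eab at *
  generalize pairSign a c = eac at *
  generalize pairSign a d = ead at *
  generalize pairSign b c = ebc at *
  generalize pairSign b d = ebd at *
  generalize pairSign c d = ecd at *
  -- The relation is multiplied by all four index signs and all six pair signs; in each term, the
  -- signs involving the multiplying variable occur twice and cancel.
  have key : ∀ s x y z u v w r : ℤ, s ^ 2 = 1 → x ^ 2 = 1 → y ^ 2 = 1 → z ^ 2 = 1 →
      s * r * (x * y * z * (u * v * w)) * (s * (x * y * z)) = r * (u * v * w) := by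
    intro s x y z u v w r hs hx hy hz
    calc _ = s ^ 2 * x ^ 2 * y ^ 2 * z ^ 2 * (r * (u * v * w)) := by ring
      _ = _ := by rw [hs, hx, hy, hz]; ring
  have ka := key sa eab eac ead ebc ebd ecd (sb * sc * sd) ha e1 e2 e3
  have kb := key sb eab ebc ebd eac ead ecd (sa * sc * sd) hb e1 e4 e5
  have kc := key sc eac ebc ecd eab ead ebd (sa * sb * sd) hc e2 e4 e6
  have kd := key sd ead ebd ecd eab eac ebc (sa * sb * sc) hd e3 e5 e6
  rw [← ka, ← kb, ← kc, ← kd]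
  have h' := congrArg (((sa * sb * sc * sd * (eab * eac * ead * ebc * ebd * ecd) : ℤ) :
    MvPolynomial (Fin (n + 1)) k) * ·) h
  push_cast at h' ⊢
  linear_combination h'

end

/-! ### The matrix `p` of the quadrics. -/

noncomputable section

open MvPolynomial

variable {k : Type*} [Field k] {n : ℕ} {α : Finset (Fin (n + 1)) → MvPolynomial (Fin (n + 1)) k}

theorem signedQuadric_eq_C_mul (a b c : Fin (n + 1)) : ∃ r : k,
    signedQuadric α a b c = C r * specialQuadric α a b c :=
  ⟨_, by rw [signedQuadric, ← map_intCast (C : k →+* _)]⟩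

theorem signedQuadric_isHomogeneous (hhom : ∀ J, (α J).IsHomogeneous 2) (a b c : Fin (n + 1)) :
    (signedQuadric α a b c).IsHomogeneous 2 := by
  obtain ⟨r, hr⟩ := signedQuadric_eq_C_mul (α := α) a b c
  rw [hr]
  exact (hhom _).C_mul r

theorem signedQuadric_coeff_sq
    (hsq : ∀ J s, coeff (Finsupp.single s 1 + Finsupp.single s 1) (α J) = 0)
    (a b c s : Fin (n + 1)) :
    coeff (Finsupp.single s 1 + Finsupp.single s 1) (signedQuadric α a b c) = 0 := by
  obtain ⟨r, hr⟩ := signedQuadric_eq_C_mul (α := α) a b c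
  rw [hr, coeff_C_mul, specialQuadric, hsq, mul_zero]

/-- Compare coefficients of `x_s² x_t` in the relation for `a, b, c, s`: any contribution from the
other three terms would be an `x_s²` coefficient of a quadric. -/
theorem signedQuadric_coeff_of_notMem (hα : koszulDiff k n α = 0)
    (hsq : ∀ J s, coeff (Finsupp.single s 1 + Finsupp.single s 1) (α J) = 0)
    {a b c s : Fin (n + 1)} (hab : a ≠ b) (hac : a ≠ c) (hbc : b ≠ c) (hsa : s ≠ a) (hsb : s ≠ b)
    (hsc : s ≠ c) (t : Fin (n + 1)) :
    coeff (Finsupp.single s 1 + Finsupp.single t 1) (signedQuadric α a b c) = 0 := by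
  have h := congrArg (coeff (Finsupp.single s 1 + (Finsupp.single s 1 + Finsupp.single t 1)))
    (signedQuadric_relation hα hab hac hsa.symm hbc hsb.symm hsc.symm)
  have hx : ∀ x y z w, s ≠ x → coeff (Finsupp.single s 1 + (Finsupp.single s 1 +
      Finsupp.single t 1)) (X x * signedQuadric α y z w) = 0 := by
    intro x y z w hsx
    by_cases htx : t = x
    · rw [← htx, ← add_assoc, add_comm _ (Finsupp.single t 1), coeff_X_mul,
        signedQuadric_coeff_sq hsq]
    · rw [coeff_X_mul', if_neg]
      simp [hsx, htx]
  rw [coeff_sub, coeff_add, coeff_sub, hx _ _ _ _ hsa, hx _ _ _ _ hsb, hx _ _ _ _ hsc,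
    coeff_X_mul, coeff_zero] at h
  simpa using h

/-- The coefficient of `x_a x_b` in the signed quadric with indices `a, b, c`. -/
def crossCoeff (α : Finset (Fin (n + 1)) → MvPolynomial (Fin (n + 1)) k)
    (c a b : Fin (n + 1)) : k :=
  coeff (Finsupp.single a 1 + Finsupp.single b 1) (signedQuadric α a b c)

theorem crossCoeff_swap (c a b : Fin (n + 1)) : crossCoeff α c b a = -crossCoeff α c a b := by
  rw [crossCoeff, crossCoeff, signedQuadric_swap_left, coeff_neg, add_comm (Finsupp.single b 1)]

theorem crossCoeff_self (c a : Fin (n + 1)) : crossCoeff α c a a = 0 := by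
  rw [crossCoeff, signedQuadric_self, coeff_zero]

/-- This is the coefficient of `x_x x_a x_b` in the relation for `x, a, b, d`. -/
theorem crossCoeff_cocycle (hα : koszulDiff k n α = 0) {a b x d : Fin (n + 1)} (hab : a ≠ b)
    (had : a ≠ d) (hbd : b ≠ d) (hxd : x ≠ d) :
    crossCoeff α d x b - crossCoeff α d x a = crossCoeff α d a b := by
  by_cases hxa : x = a
  · rw [hxa, crossCoeff_self, sub_zero]
  by_cases hxb : x = b
  · rw [hxb, crossCoeff_self, crossCoeff_swap, zero_sub, neg_neg]
  have h := congrArg (coeff (Finsupp.single x 1 + (Finsupp.single a 1 + Finsupp.single b 1)))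
    (signedQuadric_relation hα hxa hxb hxd hab had hbd)
  have ha : coeff (Finsupp.single x 1 + (Finsupp.single a 1 + Finsupp.single b 1))
      (X a * signedQuadric α x b d) = crossCoeff α d x b := by
    rw [add_left_comm, coeff_X_mul, crossCoeff]
  have hb : coeff (Finsupp.single x 1 + (Finsupp.single a 1 + Finsupp.single b 1))
      (X b * signedQuadric α x a d) = crossCoeff α d x a := by
    rw [add_comm (Finsupp.single a 1), add_left_comm, coeff_X_mul, crossCoeff]
  have hd : coeff (Finsupp.single x 1 + (Finsupp.single a 1 + Finsupp.single b 1))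
      (X d * signedQuadric α x a b) = 0 := by
    rw [coeff_X_mul', if_neg]
    simp [hxd.symm, had.symm, hbd.symm]
  rw [coeff_sub, coeff_add, coeff_sub, coeff_X_mul, coeff_zero, ha, hb, hd, ← crossCoeff] at h
  linear_combination -h

theorem signedQuadric_eq (hα : koszulDiff k n α = 0) (hhom : ∀ J, (α J).IsHomogeneous 2)
    (hsq : ∀ J s, coeff (Finsupp.single s 1 + Finsupp.single s 1) (α J) = 0)
    {a b c : Fin (n + 1)} (hab : a ≠ b) (hac : a ≠ c) (hbc : b ≠ c) :
    signedQuadric α a b c = C (crossCoeff α c a b) * (X a * X b) +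
      C (-crossCoeff α b a c) * (X a * X c) + C (crossCoeff α a b c) * (X b * X c) := by
  have h := eq_of_isHomogeneous_two (signedQuadric_isHomogeneous hhom a b c) hab hac hbc
    (signedQuadric_coeff_sq hsq a b c)
    (fun s t h1 h2 h3 => signedQuadric_coeff_of_notMem hα hsq hab hac hbc h1 h2 h3 t)
  rw [show -crossCoeff α b a c = coeff (Finsupp.single a 1 + Finsupp.single c 1)
      (signedQuadric α a b c) by
        rw [crossCoeff, signedQuadric_swap_right a b c, coeff_neg, neg_neg],
    show crossCoeff α a b c = coeff (Finsupp.single b 1 + Finsupp.single c 1)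
      (signedQuadric α a b c) by
        rw [crossCoeff, signedQuadric_swap_right b a c, signedQuadric_swap_left a b c, neg_neg]]
  exact h

open Classical in
/-- A matrix `p` with `F_{abc} = (p_{bc} - p_{ac}) x_a x_b + ⋯`, normalised with respect to the
subset `A` and the base indices `o` and `j`. -/
def potential (α : Finset (Fin (n + 1)) → MvPolynomial (Fin (n + 1)) k) (A : Set (Fin (n + 1)))
    (o j a d : Fin (n + 1)) : k :=
  if d ∈ A then crossCoeff α d j a else crossCoeff α d o a

/-- The base index of column `d` lies on the other side of `A` from `d`, so it differs from `d`, as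
`crossCoeff_cocycle` requires. -/
theorem potential_sub (hα : koszulDiff k n α = 0) {A : Set (Fin (n + 1))} {o j a b d : Fin (n + 1)}
    (ho : o ∈ A) (hj : j ∉ A) (hab : a ≠ b) (had : a ≠ d) (hbd : b ≠ d) :
    potential α A o j b d - potential α A o j a d = crossCoeff α d a b := by
  unfold potential
  split_ifs with hd
  · exact crossCoeff_cocycle hα hab had hbd (fun h => hj (h ▸ hd))
  · exact crossCoeff_cocycle hα hab had hbd (fun h => hd (h ▸ ho))

theorem isEigenpoint_potential (hα : koszulDiff k n α = 0) (hhom : ∀ J, (α J).IsHomogeneous 2)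
    (hsq : ∀ J s, coeff (Finsupp.single s 1 + Finsupp.single s 1) (α J) = 0)
    {A : Set (Fin (n + 1))} {o j : Fin (n + 1)} (ho : o ∈ A) (hj : j ∉ A)
    {z : Fin (n + 1) → k} (hz : ∀ J, eval z (α J) = 0) : IsEigenpoint (potential α A o j) z := by
  intro a b c hab hac hbc
  obtain ⟨r, hr⟩ := signedQuadric_eq_C_mul (α := α) a b c
  have h0 : eval z (signedQuadric α a b c) = 0 := by
    rw [hr, map_mul, specialQuadric, hz, mul_zero]
  rw [signedQuadric_eq hα hhom hsq hab hac hbc] at h0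
  simp only [map_add, map_mul, eval_C, eval_X] at h0
  rw [← potential_sub hα ho hj hab hac hbc, ← potential_sub hα ho hj hac hab hbc.symm,
    ← potential_sub hα ho hj hbc hab.symm hac.symm] at h0
  linear_combination h0

/-- At a point supported exactly on `A`, only the `x_o x_a` term of `F_{oal}` survives, so `p_al =
p_ol = 0`. -/
theorem potential_eq_zero (hα : koszulDiff k n α = 0) (hhom : ∀ J, (α J).IsHomogeneous 2)
    (hsq : ∀ J s, coeff (Finsupp.single s 1 + Finsupp.single s 1) (α J) = 0)
    {A : Set (Fin (n + 1))} {o j : Fin (n + 1)} (ho : o ∈ A) (hj : j ∉ A)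
    {z : Fin (n + 1) → k} (hz : ∀ J, eval z (α J) = 0) (hzA : ∀ a ∈ A, z a ≠ 0)
    (hzB : ∀ l ∉ A, z l = 0) {a l : Fin (n + 1)} (ha : a ∈ A) (hl : l ∉ A) :
    potential α A o j a l = 0 := by
  have ho0 : potential α A o j o l = 0 := by
    rw [potential, if_neg hl, crossCoeff_self]
  by_cases hoa : o = a
  · rw [← hoa, ho0]
  have h := isEigenpoint_potential hα hhom hsq ho hj hz o a l hoa (fun h => hl (h ▸ ho))
    (fun h => hl (h ▸ ha))
  rw [hzB l hl, ho0] at h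
  simpa [hzA a ha, hzA o ho] using h

theorem potential_base_eq_zero {A : Set (Fin (n + 1))} {o j a : Fin (n + 1)} (ha : a ∈ A) :
    potential α A o j j a = 0 := by
  rw [potential, if_pos ha, crossCoeff_self]

/-- The linear form cofactor of `x_j` in `F_{abj}` in terms of the matrix `p`. -/
theorem eq_of_specialQuadric_eq_X_mul (hα : koszulDiff k n α = 0)
    (hhom : ∀ J, (α J).IsHomogeneous 2)
    (hsq : ∀ J s, coeff (Finsupp.single s 1 + Finsupp.single s 1) (α J) = 0)
    {A : Set (Fin (n + 1))} {o j : Fin (n + 1)} (ho : o ∈ A) (hj : j ∉ A)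
    (hAB : ∀ a ∈ A, potential α A o j a j = 0)
    {a b : Fin (n + 1)} (ha : a ∈ A) (hb : b ∈ A) (hab : a ≠ b)
    {L : MvPolynomial (Fin (n + 1)) k} (hL : specialQuadric α a b j = X j * L) :
    ∃ r : k, L = C r * (C (potential α A o j a b) * X a - C (potential α A o j b a) * X b) := by
  have haj : a ≠ j := fun h => hj (h ▸ ha)
  have hbj : b ≠ j := fun h => hj (h ▸ hb)
  have h := signedQuadric_eq hα hhom hsq hab haj hbj
  rw [← potential_sub hα ho hj hab haj hbj, ← potential_sub hα ho hj haj hab hbj.symm,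
    ← potential_sub hα ho hj hbj hab.symm haj.symm, hAB a ha, hAB b hb,
    potential_base_eq_zero ha, potential_base_eq_zero hb, signedQuadric, hL] at h
  set s : ℤ := (-1) ^ (a + b + j : ℕ) * (pairSign a b * pairSign a j * pairSign b j) with hs
  have hs2 : s ^ 2 = 1 := by
    rw [hs, mul_pow, mul_pow, mul_pow, pairSign_sq hab, pairSign_sq haj, pairSign_sq hbj]
    rcases neg_one_pow_eq_or ℤ (a + b + j : ℕ) with h | h <;> rw [h] <;> norm_num
  have hs2' : ((s : MvPolynomial (Fin (n + 1)) k)) ^ 2 = 1 := by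
    rw [← Int.cast_pow, hs2, Int.cast_one]
  refine ⟨(s : k), mul_left_cancel₀ (X_ne_zero j) ?_⟩
  rw [map_intCast]
  simp only [sub_self, zero_sub, neg_neg, map_neg, map_zero, zero_mul, zero_add] at h
  linear_combination (s : MvPolynomial (Fin (n + 1)) k) * h - X j * L * hs2'

end

/-! ### The dimension of `W_j`, and linear subspaces in coordinates. -/

noncomputable section

open MvPolynomial

/-- A space of linear forms in the variables `x_a`, `a ∈ A`, generated by binomials that vanish at
two points with independent projections has codimension at least two. -/
theorem finrank_span_binomials_add_two_le {k σ : Type*} [Field k] (A : Finset σ)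
    (G : Set (MvPolynomial σ k)) (v w : σ → k) (hv : ∃ a ∈ A, v a ≠ 0)
    (hvw : ∀ ζ, ∃ a ∈ A, w a ≠ ζ * v a)
    (hG : ∀ L ∈ G, ∃ a ∈ A, ∃ b ∈ A, ∃ r p q : k, L = C r * (C p * X a - C q * X b) ∧
      p * v a = q * v b ∧ p * w a = q * w b) :
    Module.finrank k (Submodule.span k G) + 2 ≤ A.card := by
  classical
  -- The coefficient vectors of the binomials lie in the kernel of the matrix with rows `v` and `w`,
  -- which has rank `2`.
  let M : Matrix (Fin 2) A k := ![fun a => v a, fun a => w a]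
  have hM : LinearIndependent k M.row := by
    have : M.row = ![fun a : A => v a, fun a : A => w a] := rfl
    rw [this, LinearIndependent.pair_iff']
    · intro ζ h
      obtain ⟨a, ha, hne⟩ := hvw ζ
      exact hne (congrFun h ⟨a, ha⟩).symm
    · intro h
      obtain ⟨a, ha, hne⟩ := hv
      exact hne (congrFun h ⟨a, ha⟩)
  have hrank : Module.finrank k (LinearMap.range M.mulVecLin) = 2 := by
    have := hM.rank_matrix
    rwa [Fintype.card_fin] at this
  have hker := LinearMap.finrank_range_add_finrank_ker M.mulVecLin
  rw [hrank, Module.finrank_fintype_fun_eq_card, Fintype.card_coe] at hker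
  let Φ : (A → k) →ₗ[k] MvPolynomial σ k := Fintype.linearCombination k fun a : A => X (a : σ)
  have hΦ : ∀ (a : A) (x : k), Φ (Pi.single a x) = C x * X (a : σ) := fun a x => by
    simp [Φ, Fintype.linearCombination_apply_single, smul_eq_C_mul]
  have hle : Submodule.span k G ≤ (LinearMap.ker M.mulVecLin).map Φ := by
    refine Submodule.span_le.2 fun L hL => ?_
    obtain ⟨a, ha, b, hb, r, p, q, rfl, h1, h2⟩ := hG L hL
    refine ⟨r • (Pi.single ⟨a, ha⟩ p - Pi.single ⟨b, hb⟩ q), ?_, ?_⟩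
    · refine Submodule.smul_mem _ _ ?_
      rw [LinearMap.mem_ker, Matrix.mulVecLin_apply, Matrix.mulVec_sub, Matrix.mulVec_single,
        Matrix.mulVec_single, sub_eq_zero]
      ext t
      fin_cases t
      · simpa [M, Matrix.col, Matrix.transpose, mul_comm] using h1
      · simpa [M, Matrix.col, Matrix.transpose, mul_comm] using h2
    · rw [map_smul, map_sub, hΦ, hΦ, smul_eq_C_mul]
  have := (Submodule.finrank_mono hle).trans (Submodule.finrank_map_le Φ _)
  omega

section Coordinates

variable {k : Type*} [Field k] {n : ℕ} (e : Module.Basis (Fin (n + 1)) k (Fin (n + 1) → k))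

theorem liesOn_iff_rep_mem (P : ℙ k (Fin (n + 1) → k)) (S : Submodule k (Fin (n + 1) → k)) :
    LiesOn P S ↔ P.rep ∈ S := by
  rw [LiesOn, Projectivization.submodule_eq, Submodule.span_singleton_le_iff_mem]

theorem liesOn_span_image_iff (P : ℙ k (Fin (n + 1) → k)) (s : Set (Fin (n + 1))) :
    LiesOn P (Submodule.span k (e '' s)) ↔ ∀ l ∉ s, homCoords e P l = 0 := by
  rw [liesOn_iff_rep_mem, e.mem_span_image]
  refine ⟨fun h l hl => ?_, fun h l hl => ?_⟩
  · by_contra h0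
    exact hl (h (Finsupp.mem_support_iff.2 h0))
  · by_contra h0
    exact Finsupp.mem_support_iff.1 hl (h l h0)

theorem range_comp_basis_coe (s : Finset (Fin (n + 1))) :
    Set.range (e ∘ ((↑) : s → Fin (n + 1))) = e '' s := by
  rw [Set.range_comp, Subtype.range_coe]

theorem finrank_span_basis_image (s : Finset (Fin (n + 1))) :
    Module.finrank k (Submodule.span k (e '' s)) = s.card := by
  have h := finrank_span_eq_card (e.linearIndependent.comp ((↑) : s → Fin (n + 1))
    Subtype.val_injective)
  rwa [range_comp_basis_coe, Fintype.card_coe] at h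

theorem finrank_span_insert_basis_image (s : Finset (Fin (n + 1))) {u : Fin (n + 1) → k}
    (hu : u ∉ Submodule.span k (e '' s)) :
    Module.finrank k (Submodule.span k (insert u (e '' s))) = s.card + 1 := by
  have hr := range_comp_basis_coe e s
  have h := finrank_span_eq_card (linearIndependent_option'.2 ⟨e.linearIndependent.comp
    ((↑) : s → Fin (n + 1)) Subtype.val_injective, hr ▸ hu⟩)
  rw [Fintype.card_option, Fintype.card_coe] at h
  have hins : Set.range (fun o : Option s => Option.casesOn' o u (e ∘ ((↑) : s → Fin (n + 1)))) =
      insert u (e '' s) := by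
    rw [← hr]
    ext x
    simp only [Set.mem_range, Option.exists, Option.casesOn'_none, Option.casesOn'_some,
      Set.mem_insert_iff, @eq_comm _ u x]
  rwa [hins] at h

theorem homCoords_basis_self_ne_zero (l : Fin (n + 1)) :
    homCoords e (Projectivization.mk k (e l) (e.ne_zero l)) l ≠ 0 ∧
      ∀ t, t ≠ l → homCoords e (Projectivization.mk k (e l) (e.ne_zero l)) t = 0 := by
  obtain ⟨a, ha⟩ := Projectivization.exists_smul_eq_mk_rep k (e l) (e.ne_zero l)
  unfold homCoords
  rw [← ha]
  refine ⟨?_, fun t ht => ?_⟩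
  · simp [Units.smul_def]
  · simp [Units.smul_def, Finsupp.single_eq_of_ne ht]

theorem basisPoint_injective :
    Function.Injective fun l => Projectivization.mk k (e l) (e.ne_zero l) := by
  intro l t h
  by_contra hne
  have h1 := (homCoords_basis_self_ne_zero e t).2 l hne
  simp only at h
  rw [← h] at h1
  exact (homCoords_basis_self_ne_zero e l).1 h1

theorem eval_eq_zero_of_mem_definingIdeal {X : Finset (ℙ k (Fin (n + 1) → k))}
    {f : MvPolynomial (Fin (n + 1)) k} (hf : f ∈ definingIdeal e X)
    {P : ℙ k (Fin (n + 1) → k)} (hP : P ∈ X) : eval (homCoords e P) f = 0 := by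
  have : definingIdeal e X ≤ RingHom.ker (eval (homCoords e P)) := by
    refine Ideal.span_le.2 ?_
    rintro g ⟨d, -, hg⟩
    exact hg P hP
  exact this hf

/-- Points separated by a set of coordinates lie on two complementary linear subspaces. -/
theorem exists_complementary_subspaces {X : Finset (ℙ k (Fin (n + 1) → k))}
    {K : Finset (Fin (n + 1))} (hK : K.Nonempty) (hKn : K.card < n) {u : Fin (n + 1) → k}
    (hu : ∃ a ∉ K, u a ≠ 0)
    (h : ∀ P ∈ X, (∀ l ∈ K, homCoords e P l = 0) ∨ ∃ ζ, ∀ l ∉ K, homCoords e P l = ζ * u l) :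
    ∃ r s : ℕ, 0 < r ∧ 0 < s ∧ r + s = n ∧
      ∃ S T : Submodule k (Fin (n + 1) → k),
        Module.finrank k S = r + 1 ∧ Module.finrank k T = s + 1 ∧
          ∀ P ∈ X, LiesOn P S ∨ LiesOn P T := by
  have hcard := hK.card_pos
  have hrepr : ∀ l, e.repr (e.equivFun.symm u) l = u l := fun l => by
    rw [← e.equivFun_apply, LinearEquiv.apply_symm_apply]
  refine ⟨n - K.card, K.card, by omega, hcard, by omega, Submodule.span k (e '' (Kᶜ : Finset _)),
    Submodule.span k (insert (e.equivFun.symm u) (e '' K)), ?_, ?_, fun P hP => ?_⟩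
  · rw [finrank_span_basis_image, Finset.card_compl, Fintype.card_fin]
    omega
  · refine finrank_span_insert_basis_image e K fun hmem => ?_
    obtain ⟨a, ha, hua⟩ := hu
    rw [e.mem_span_image] at hmem
    exact ha (hmem (Finsupp.mem_support_iff.2 (by rwa [hrepr])))
  · refine (h P hP).imp (fun h => ?_) fun ⟨ζ, hζ⟩ => ?_
    · rw [liesOn_span_image_iff]
      intro l hl
      exact h l (by simpa using hl)
    · rw [liesOn_iff_rep_mem, Submodule.mem_span_insert]
      refine ⟨ζ, P.rep - ζ • e.equivFun.symm u, ?_, (add_sub_cancel _ _).symm⟩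
      rw [e.mem_span_image]
      intro l hl
      by_contra hlK
      refine Finsupp.mem_support_iff.1 hl ?_
      rw [map_sub, map_smul, Finsupp.sub_apply, Finsupp.smul_apply, hrepr, smul_eq_mul, sub_eq_zero]
      exact hζ l hlK

/-- A subset of more than `|A|` points on the subspace spanned by the coordinate points of `A`
contains a point all of whose coordinates in `A` are nonzero, if any `|A|` points are
independent. -/
theorem exists_point_coords_ne_zero {X : Finset (ℙ k (Fin (n + 1) → k))}
    (A : Finset (Fin (n + 1)))
    (hgen : ∀ Y ⊆ X, Y.card = A.card → ∀ S : Submodule k (Fin (n + 1) → k),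
      Module.finrank k S = A.card - 1 → ¬ ∀ P ∈ Y, LiesOn P S)
    (hcoord : ∀ l : Fin (n + 1), Projectivization.mk k (e l) (e.ne_zero l) ∈ X)
    {Y : Finset (ℙ k (Fin (n + 1) → k))} (hYX : Y ⊆ X) (hY : Y.card = A.card + 1)
    (hYA : ∀ P ∈ Y, ∀ l ∉ A, homCoords e P l = 0) :
    ∃ Q ∈ X, (∀ a ∈ A, homCoords e Q a ≠ 0) ∧ ∀ l ∉ A, homCoords e Q l = 0 := by
  classical
  -- `Y` has one point more than there are coordinate points of `A`. If `Q` had a zero coordinate at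
  -- `a ∈ A`, then `Q` and the other coordinate points of `A` would be `|A|` points on a subspace of
  -- vector space dimension `|A| - 1`.
  obtain ⟨Q, hQY, hQ⟩ := Finset.exists_mem_notMem_of_card_lt_card
    (s := A.image fun l => Projectivization.mk k (e l) (e.ne_zero l)) (t := Y)
    (by rw [hY, Finset.card_image_of_injective _ (basisPoint_injective e)]; omega)
  refine ⟨Q, hYX hQY, fun a ha hQa => ?_, hYA Q hQY⟩
  refine hgen (insert Q ((A.erase a).image fun l => Projectivization.mk k (e l) (e.ne_zero l)))
    ?_ ?_ (Submodule.span k (e '' (A.erase a))) ?_ ?_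
  · intro P hP
    rcases Finset.mem_insert.1 hP with rfl | hP
    · exact hYX hQY
    · obtain ⟨l, -, rfl⟩ := Finset.mem_image.1 hP
      exact hcoord l
  · rw [Finset.card_insert_of_notMem, Finset.card_image_of_injective _ (basisPoint_injective e),
      Finset.card_erase_add_one ha]
    exact fun h => hQ (Finset.image_subset_image (Finset.erase_subset _ _) h)
  · rw [finrank_span_basis_image, Finset.card_erase_of_mem ha]
  · intro P hP
    rw [liesOn_span_image_iff]
    intro l hl
    rcases Finset.mem_insert.1 hP with rfl | hP
    · by_cases hla : l = a
      · rw [hla, hQa]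
      · exact hYA _ hQY l fun h => hl (by simp [hla, h])
    · obtain ⟨t, ht, rfl⟩ := Finset.mem_image.1 hP
      exact (homCoords_basis_self_ne_zero e t).2 l fun h => hl (h ▸ ht)

end Coordinates

end

/-! ### The main theorem. -/

theorem theorem5p4 {k : Type*} [Field k] [IsAlgClosed k] (n i : ℕ) (hi : i + 2 ≤ n)
    (X : Finset (ℙ k (Fin (n + 1) → k)))
    -- `X` spans `ℙ^n`
    (hspan : ∀ S : Submodule k (Fin (n + 1) → k), (∀ P ∈ X, LiesOn P S) → S = ⊤)
    -- `n - i` points of `X` are never on a `ℙ^(n-i-2)`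
    (hgen : ∀ Y ⊆ X, Y.card = n - i →
      ∀ S : Submodule k (Fin (n + 1) → k), Module.finrank k S = n - i - 1 →
        ¬ ∀ P ∈ Y, LiesOn P S)
    -- coordinates in which the coordinate points belong to `X` and the `ℙ^(n-i-1)` with equations
    -- `x_{n-i} = ⋯ = x_n = 0` contains `n - i + 1` points of `X`
    (e : Module.Basis (Fin (n + 1)) k (Fin (n + 1) → k))
    (hcoord : ∀ l : Fin (n + 1), Projectivization.mk k (e l) (e.ne_zero l) ∈ X)
    (hplane : ∃ Y ⊆ X, Y.card = n - i + 1 ∧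
      ∀ P ∈ Y, ∀ l : Fin (n + 1), n - i ≤ (l : ℕ) → homCoords e P l = 0)
    -- the element `α` of `(⋀^{n-2} V ⊗ I_2) ∩ K_{n-2}` which defines the quadrics `F_{abc}`
    (α : Finset (Fin (n + 1)) → MvPolynomial (Fin (n + 1)) k) (hα : α ∈ koszulCycles e X)
    (j : Fin (n + 1)) (hj : n - i ≤ (j : ℕ))
    (hW : n - i - 1 ≤ Module.finrank k (spaceW i α j)) :
    ∃ r s : ℕ, 0 < r ∧ 0 < s ∧ r + s = n ∧
      ∃ S T : Submodule k (Fin (n + 1) → k),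
        Module.finrank k S = r + 1 ∧ Module.finrank k T = s + 1 ∧
          ∀ P ∈ X, LiesOn P S ∨ LiesOn P T := by
  classical
  set A : Finset (Fin (n + 1)) := Finset.univ.filter fun l => (l : ℕ) < n - i with hA
  have hmemA : ∀ l, l ∈ A ↔ (l : ℕ) < n - i := fun l => by simp [hA]
  have hAcard : A.card = n - i := by
    rw [hA, Fin.card_filter_val_lt]
    omega
  have heval : ∀ P ∈ X, ∀ J, MvPolynomial.eval (homCoords e P) (α J) = 0 := fun P hP J =>
    eval_eq_zero_of_mem_definingIdeal e (hα.1 J).1 hP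
  have hhom : ∀ J, (α J).IsHomogeneous 2 := fun J => (hα.1 J).2
  have hd : koszulDiff k n α = 0 := hα.2.2
  have hsq : ∀ J s, MvPolynomial.coeff (Finsupp.single s 1 + Finsupp.single s 1) (α J) = 0 :=
    fun J s => MvPolynomial.coeff_single_add_single_self_eq_zero (hhom J)
      (homCoords_basis_self_ne_zero e s).1 (homCoords_basis_self_ne_zero e s).2
      (heval _ (hcoord s) J)
  obtain ⟨Y, hYX, hYcard, hYA⟩ := hplane
  obtain ⟨Q, hQX, hQA, hQB⟩ := exists_point_coords_ne_zero e A (by rwa [hAcard]) hcoord hYX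
    (by rw [hYcard, hAcard]) fun P hP l hl => hYA P hP l (by rw [hmemA] at hl; omega)
  have hj' : j ∉ (A : Set (Fin (n + 1))) := fun h => by
    have := (hmemA j).1 h
    omega
  have ho : (0 : Fin (n + 1)) ∈ (A : Set (Fin (n + 1))) := (hmemA 0).2 (by simp; omega)
  have hAB : ∀ a ∈ (A : Set (Fin (n + 1))), ∀ l ∉ (A : Set (Fin (n + 1))),
      potential α (A : Set (Fin (n + 1))) 0 j a l = 0 := fun a ha l hl =>
    potential_eq_zero hd hhom hsq ho hj' (heval Q hQX) hQA hQB ha hl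
  obtain ⟨K, u, hK, hKA, ⟨a, ha, hua⟩, hsep⟩ := exists_separating_indices
    (Z := homCoords e '' X) (p := potential α (A : Set (Fin (n + 1))) 0 j) (j := j)
    (by
      rintro _ ⟨P, hP, rfl⟩
      exact isEigenpoint_potential hd hhom hsq ho hj' (heval P hP))
    ⟨0, ho⟩ hAB ⟨hj', fun a ha => potential_base_eq_zero ha⟩ (by
      -- Two independent common zeros would force `dim W_j ≤ |A| - 2 = n - i - 2`.
      intro v w hv hv' hw'
      by_contra hcon
      push Not at hcon
      have h := finrank_span_binomials_add_two_le A {L | L.IsHomogeneous 1 ∧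
        ∃ a b : Fin (n + 1), a < b ∧ (b : ℕ) ≤ n - i - 1 ∧
          specialQuadric α a b j = MvPolynomial.X j * L} v w hv hcon (by
        rintro L ⟨-, a, b, hab, hb, hL⟩
        have hbA : b ∈ A := (hmemA b).2 (by omega)
        have haA : a ∈ A := (hmemA a).2 (by have : (a : ℕ) < b := hab; omega)
        obtain ⟨r, hr⟩ := eq_of_specialQuadric_eq_X_mul hd hhom hsq ho hj'
          (fun a ha => hAB a ha j hj') haA hbA hab.ne hL
        exact ⟨a, haA, b, hbA, r, _, _, hr, hv' a haA b hbA hab.ne, hw' a haA b hbA hab.ne⟩)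
      rw [hAcard] at h
      have h' : Module.finrank k (spaceW i α j) + 2 ≤ n - i := h
      omega)
  refine exists_complementary_subspaces e hK ?_ ⟨a, fun h => hKA a h ha, hua⟩
    fun P hP => hsep _ ⟨P, hP, rfl⟩
  -- Since `|A| = n - i ≥ 2`, this gives `|K| < n`, so that `r = n - |K|` is positive.
  have h1 : K.card + A.card ≤ n + 1 := by
    rw [← Finset.card_union_of_disjoint (Finset.disjoint_left.2 hKA)]
    exact (Finset.card_le_univ _).trans (by simp)
  omega
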